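/- Let $\sigma_1,\sigma_2,\sigma_3$ be the Pauli matrices and, in $2\times2$ blocks, put $$J_a=\tfrac12\begin{bmatrix}\sigma_a&0\\0&\sigma_a\end{bmatrix},\qquad K_a=\tfrac12\begin{bmatrix}0&1\\-1&0\end{bmatrix}\begin{bmatrix}\sigma_a&0\\0&\sigma_a\end{bmatrix}\qquad(a=1,2,3).$$ Let $SU_{\mathcal D}(2)=\left\{\begin{bmatrix}U&0\\0&U\end{bmatrix}: U\in SU(2)\right\}$. Let $G\subset GL(4,\mathbb C)$ be the connected Lie subgroup whose real Lie algebra is generated by the anti-Hermitian matrices $iJ_a,K_a$ (that is, the subgroup generated by the exponentials of elements of this Lie algebra), and let $G'\subset GL(4,\mathbb C)$ be the connected Lie subgroup whose real Lie algebra, isomorphic to $\mathfrak{so}(1,3)$, is generated by the matrices $iJ_a,iK_a$. Both carry the topology of groups of matrices, and coset spaces carry the quotient topology. Then $G$ is a compact subgroup of $SU(4)$ containing $SU_{\mathcal D}(2)$, the homogeneous space $G/SU_{\mathcal D}(2)$ is path-connected, and $$\pi_1\bigl(G/SU_{\mathcal D}(2)\bigr)=0 .$$ Likewise $SU_{\mathcal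 D}(2)\subset G'$, the space $G'/SU_{\mathcal D}(2)$ is path-connected, and $\pi_1\bigl(G'/SU_{\mathcal D}(2)\bigr)=0$. -/

import Mathlib

noncomputable section

attribute [local instance 100] LieRing.ofAssociativeRing

/-- The Pauli matrices `σ₁, σ₂, σ₃` (indexed by `0, 1, 2`). -/
def pauli : Fin 3 → Matrix (Fin 2) (Fin 2) ℂ :=
  ![!![0, 1; 1, 0], !![0, -Complex.I; Complex.I, 0], !![1, 0; 0, -1]]

/-- `J_a = (1/2) [σ_a 0; 0 σ_a]`, a complex `4 × 4` matrix written in `2 × 2` blocks. -/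
def genJ (a : Fin 3) : Matrix (Fin 2 ⊕ Fin 2) (Fin 2 ⊕ Fin 2) ℂ :=
  (1 / 2 : ℂ) • Matrix.fromBlocks (pauli a) 0 0 (pauli a)

/-- `K_a = (1/2) [0 1; -1 0] [σ_a 0; 0 σ_a]`. -/
def genK (a : Fin 3) : Matrix (Fin 2 ⊕ Fin 2) (Fin 2 ⊕ Fin 2) ℂ :=
  (1 / 2 : ℂ) • (Matrix.fromBlocks 0 1 (-1) 0 * Matrix.fromBlocks (pauli a) 0 0 (pauli a))

/-- The connected Lie subgroup of `GL(4, ℂ)` with Lie algebra `𝔤`: the subgroup generated by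
the exponentials of the elements of `𝔤`. -/
def connectedLieSubgroup
    (𝔤 : LieSubalgebra ℝ (Matrix (Fin 2 ⊕ Fin 2) (Fin 2 ⊕ Fin 2) ℂ)) :
    Subgroup (Matrix.GeneralLinearGroup (Fin 2 ⊕ Fin 2) ℂ) :=
  Subgroup.closure
    {u | ∃ X ∈ 𝔤, (u : Matrix (Fin 2 ⊕ Fin 2) (Fin 2 ⊕ Fin 2) ℂ) = NormedSpace.exp X}

/-- The Dirac representation `U ↦ [U 0; 0 U]` of `SU(2)`. -/
def diracRep :
    Matrix.specialUnitaryGroup (Fin 2) ℂ →* Matrix.GeneralLinearGroup (Fin 2 ⊕ Fin 2) ℂ :=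
  MonoidHom.toHomUnits
    { toFun := fun U => Matrix.fromBlocks (U : Matrix (Fin 2) (Fin 2) ℂ) 0 0 U
      map_one' := by simp
      map_mul' := fun U V => by simp [Matrix.fromBlocks_multiply] }

/-- `SU_D(2)`, the image of the Dirac representation. -/
def diracSU2 : Subgroup (Matrix.GeneralLinearGroup (Fin 2 ⊕ Fin 2) ℂ) :=
  diracRep.range

/-- The real Lie algebra generated by the anti-Hermitian matrices `i J_a` and `K_a`: the compact
real form, inside `𝔰𝔲(4)`, of the complex Lie algebra generated by the `J_a` and `K_a`. -/
def compactLieAlg : LieSubalgebra ℝ (Matrix (Fin 2 ⊕ Fin 2) (Fin 2 ⊕ Fin 2) ℂ) :=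
  LieSubalgebra.lieSpan ℝ _
    (Set.range (fun a => Complex.I • genJ a) ∪ Set.range genK)

/-- The real Lie algebra generated by the matrices `i J_a` and `i K_a`, isomorphic to
`𝔰𝔬(1, 3)`. -/
def lorentzLieAlg : LieSubalgebra ℝ (Matrix (Fin 2 ⊕ Fin 2) (Fin 2 ⊕ Fin 2) ℂ) :=
  LieSubalgebra.lieSpan ℝ _
    (Set.range (fun a => Complex.I • genJ a) ∪ Set.range (fun a => Complex.I • genK a))

/-- The compact connected group `G ⊆ SU(4)`. -/
def compactG : Subgroup (Matrix.GeneralLinearGroup (Fin 2 ⊕ Fin 2) ℂ) :=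
  connectedLieSubgroup compactLieAlg

/-- The connected group generated by the matrices `exp i(θ^b J_b + κ^a K_a)`. -/
def lorentzG : Subgroup (Matrix.GeneralLinearGroup (Fin 2 ⊕ Fin 2) ℂ) :=
  connectedLieSubgroup lorentzLieAlg

/-- The homogeneous space `G / SU_D(2)`, with the quotient topology of the topology of `G` as a
group of matrices. -/
abbrev homogeneousSpace (G : Subgroup (Matrix.GeneralLinearGroup (Fin 2 ⊕ Fin 2) ℂ)) : Type :=
  G ⧸ diracSU2.subgroupOf G

end

/-!
Let `blockEmbedding : M₂(ℂ) × M₂(ℂ) → M₄(ℂ)` be the isomorphism onto the commutant of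
`ε = [0 1; -1 0]` for which the two factors act on the eigenspaces of `ε` for `i` and `-i`. It sends
`(σ_a / 2, σ_a / 2)` to `J_a` and `(i σ_a / 2, -i σ_a / 2)` to `K_a`. Hence it carries
`𝔰𝔲(2) × 𝔰𝔲(2)` to the compact Lie algebra and the graph `{(X, -Xᴴ)}` over `𝔰𝔩(2, ℂ)` to the Lorentz
Lie algebra, while `SU_D(2)` is the image of the diagonal of `SU(2) × SU(2)`.

* The compact group is the image of `SU(2) × SU(2)` (`compactG_eq_range`): one inclusion holds
  because exponentials of traceless skew-Hermitian matrices lie in `SU(2)`, the other because the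
  exponential map of `SU(2)` is surjective. So it is compact and contained in `SU(4)`. Its quotient
  by the diagonal is `SU(2)` through `(U, V) ↦ U V⁻¹`, a three-sphere and therefore a retract of
  `ℂ² \ {0}`, which is simply connected (`isSimplyConnected_compl_zero`).
* The Lorentz group is contained in the image of `SL(2, ℂ)` under `P ↦ (P, (P⁻¹)ᴴ)` and contains the
  images of `SU(2)` and of the positive definite Hermitian matrices of determinant one. By polar
  decomposition its quotient by `SU(2)` is a retract of the space of those Hermitian matrices, which
  is parametrised by the vector space `ℝ × ℂ` of traceless parts.

Both quotients are handled by `simplyConnectedSpace_quotient`: an invariant continuous map to a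
simply connected space, with a continuous lift back to the group, exhibits the quotient as a
retract of that space, and retracts of simply connected spaces are simply connected.
-/

open NormedSpace (exp)
open ComplexConjugate
open scoped unitInterval MatrixGroups

attribute [local instance] LieRing.ofAssociativeRing

/-! ### Simply connected spaces -/

/-- A retract of a simply connected space is simply connected. -/
theorem SimplyConnectedSpace.of_leftInverse {X Y : Type*} [TopologicalSpace X]
    [TopologicalSpace Y] [SimplyConnectedSpace Y] {f : X → Y} {g : Y → X} (hf : Continuous f)
    (hg : Continuous g) (h : Function.LeftInverse g f) : SimplyConnectedSpace X := by
  rw [simply_connected_iff_loops_nullhomotopic]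
  refine ⟨h.surjective.pathConnectedSpace hg, fun x γ => ?_⟩
  have key := ((SimplyConnectedSpace.paths_homotopic (γ.map hf) (Path.refl (f x))).map
    ⟨g, hg⟩)
  obtain ⟨F⟩ := key
  refine ⟨⟨⟨⟨F, F.continuous⟩, fun t => ?_, fun t => ?_⟩, fun t s hs => ?_⟩⟩
  · simp [h (γ t)]
  · simp [h x]
  · have := F.eq_fst t hs
    simpa [h (γ s)] using this

/-- The complement of the closed ray through a nonzero vector is star-shaped. -/
theorem starConvex_compl_ray {V : Type*} [AddCommGroup V] [Module ℝ V] {v : V} (hv : v ≠ 0) :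
    StarConvex ℝ (-v) {x : V | ∀ t : ℝ, 0 ≤ t → x ≠ t • v} := by
  intro y hy a b ha hb hab t ht h
  rcases hb.eq_or_lt with rfl | hb
  · obtain rfl : a = 1 := by linarith
    have : (1 + t) • v = 0 := by rw [add_smul, ← h]; simp
    exact (smul_ne_zero (by positivity) hv) this
  · refine hy ((t + a) / b) (by positivity) ?_
    have : b • y = (t + a) • v := by rw [add_smul, ← h]; simp
    rw [div_eq_inv_mul, mul_smul, ← this, smul_smul, inv_mul_cancel₀ hb.ne', one_smul]

/-- The straight-line homotopy between two paths with the same endpoints. -/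
def Path.Homotopy.segment {V : Type*} [AddCommGroup V] [Module ℝ V] [TopologicalSpace V]
    [IsTopologicalAddGroup V] [ContinuousSMul ℝ V] {x y : V} (p q : Path x y) :
    p.Homotopy q where
  toFun z := p z.2 + (z.1 : ℝ) • (q z.2 - p z.2)
  map_zero_left := by simp
  map_one_left := by simp
  prop' := by
    rintro t s (rfl | rfl) <;> simp

/-- In dimension at least three the complement of the origin is simply connected: a loop is
moved by a short straight-line homotopy onto a polynomial loop, the cone over a polynomial loop
has dimension at most two and so misses some vector `v`, and the complement of the ray through
`v` is star-shaped. -/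
theorem isSimplyConnected_compl_zero {V : Type*} [NormedAddCommGroup V] [NormedSpace ℝ V]
    [FiniteDimensional ℝ V] (hV : 2 < Module.finrank ℝ V) :
    IsSimplyConnected ({0}ᶜ : Set V) := by
  rw [isSimplyConnected_iff_exists_homotopy_refl_forall_mem]
  refine ⟨isPathConnected_compl_singleton_of_one_lt_rank ?_ 0, fun x p hp => ?_⟩
  · rw [← Module.finrank_eq_rank]
    exact_mod_cast (by omega : 1 < Module.finrank ℝ V)
  obtain ⟨δ, hδ, hpδ⟩ : ∃ δ > 0, ∀ t, δ ≤ ‖p t‖ := by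
    obtain ⟨t₀, -, ht₀⟩ := isCompact_univ.exists_isMinOn (Set.univ_nonempty (α := I))
      (p.continuous.norm.continuousOn)
    exact ⟨‖p t₀‖, norm_pos_iff.2 (hp t₀), fun t => ht₀ (Set.mem_univ t)⟩
  obtain ⟨n, hn₀, hn⟩ : ∃ n ≠ 0, dist (bernsteinApproximation n p.toContinuousMap)
      p.toContinuousMap < δ :=
    (((Filter.eventually_ne_atTop 0).and
      (Metric.tendsto_nhds.1 (bernsteinApproximation_uniform p.toContinuousMap) δ hδ))).exists
  let q : Path x x :=
    { toContinuousMap := bernsteinApproximation n p.toContinuousMap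
      source' := by simp
      target' := by simp [hn₀] }
  have hq : ∀ t, ‖q t - p t‖ < δ := fun t => by
    rw [← dist_eq_norm]
    exact (ContinuousMap.dist_apply_le_dist (f := bernsteinApproximation n p.toContinuousMap)
      (g := p.toContinuousMap) t).trans_lt hn
  have hpq : ∀ z, Path.Homotopy.segment p q z ∈ ({0}ᶜ : Set V) := by
    rintro ⟨s, t⟩ (h : p t + (s : ℝ) • (q t - p t) = 0)
    have h1 : p t = -((s : ℝ) • (q t - p t)) := eq_neg_of_add_eq_zero_left h
    have h2 : ‖p t‖ ≤ ‖q t - p t‖ := by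
      rw [h1, norm_neg, norm_smul, Real.norm_of_nonneg s.2.1, ← h1]
      exact mul_le_of_le_one_left (norm_nonneg _) s.2.2
    exact absurd (hpδ t) (not_le.2 (h2.trans_lt (hq t)))
  have hq0 : ∀ t, q t ≠ 0 := fun t => by simpa using hpq (1, t)
  -- The cone over the polynomial extension of `q` to the whole real line.
  let F : ℝ × ℝ → V := fun z => z.1 • ∑ k : Fin (n + 1),
    ((n.choose k : ℝ) * z.2 ^ (k : ℕ) * (1 - z.2) ^ (n - k)) •
      p (bernstein.z k)
  have hF : ContDiff ℝ 1 F := by fun_prop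
  obtain ⟨v, hv⟩ := (hF.dense_compl_range_of_finrank_lt_finrank (by simpa using hV)).nonempty
  have hFq : ∀ (s : ℝ) (t : I), F (s, t) = s • q t := fun s t => by
    have : q t = bernsteinApproximation n p.toContinuousMap t := rfl
    rw [this, bernsteinApproximation.apply]
    simp [F, bernstein_apply]
  have hv0 : v ≠ 0 := by
    rintro rfl
    exact hv ⟨(0, 0), by simp [F]⟩
  let E : Set V := {x : V | ∀ t : ℝ, 0 ≤ t → x ≠ t • v}
  have hqE : ∀ t, q t ∈ E := by
    intro t s _ h
    have hs : s ≠ 0 := by rintro rfl; exact hq0 t (by simpa using h)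
    exact hv ⟨(s⁻¹, t), by rw [hFq, h, smul_smul, inv_mul_cancel₀ hs, one_smul]⟩
  have hE : IsSimplyConnected E := by
    have := (starConvex_compl_ray hv0).contractibleSpace ⟨q 0, hqE 0⟩
    exact SimplyConnectedSpace.ofContractible E
  obtain ⟨K, hK⟩ := (isSimplyConnected_iff_exists_homotopy_refl_forall_mem.1 hE).2 x q hqE
  refine ⟨(Path.Homotopy.segment p q).trans K, fun z => ?_⟩
  rw [Path.Homotopy.trans_apply]
  split_ifs
  · exact hpq _
  · exact fun h => hK _ 0 le_rfl (by simpa using h)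

/-! ### Matrix exponentials -/

/-- The exponential series of a complex matrix converges for the product topology. -/
theorem Matrix.hasSum_exp {n : Type*} [Fintype n] [DecidableEq n] (A : Matrix n n ℂ) :
    HasSum (fun k : ℕ => ((k.factorial : ℂ)⁻¹) • A ^ k) (exp A) := by
  have hA := open scoped Matrix.Norms.Operator in NormedSpace.exp_series_hasSum_exp' (𝕂 := ℂ) A
  convert! hA

/-- A continuous ring homomorphism out of a product of two matrix algebras commutes with the
exponential. -/
theorem Matrix.map_exp_prod {m n : Type*} [Fintype m] [DecidableEq m] [Fintype n] [DecidableEq n]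
    (f : Matrix m m ℂ × Matrix m m ℂ →+* Matrix n n ℂ) (hf : Continuous f) (A B : Matrix m m ℂ) :
    exp (f (A, B)) = f (exp A, exp B) := by
  have h := ((Matrix.hasSum_exp A).prodMk (Matrix.hasSum_exp B)).map f hf
  refine (Matrix.hasSum_exp (f (A, B))).unique (h.congr_fun fun k => ?_)
  rw [Function.comp_apply, ← Prod.smul_mk, ← Prod.pow_mk, map_inv_natCast_smul f ℂ ℂ, map_pow]

theorem Matrix.exp_smul_of_mul_self_eq_one {n : Type*} [Fintype n] [DecidableEq n]
    {N : Matrix n n ℂ} (hN : N * N = 1) (z : ℂ) :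
    exp (z • N) = Complex.cosh z • (1 : Matrix n n ℂ) + Complex.sinh z • N := by
  -- The spectral projections of `N` for the eigenvalues `1` and `-1` are `(1 ± N) / 2`.
  have hpow : ∀ k : ℕ, N ^ k = (1 / 2 : ℂ) • (1 + N) + ((-1) ^ k / 2 : ℂ) • (1 - N) := by
    intro k
    induction k with
    | zero => simp only [pow_zero]; module
    | succ k ih =>
      rw [pow_succ, ih, add_mul, smul_mul_assoc, smul_mul_assoc, add_mul, sub_mul, one_mul, hN]
      module
  have hc : ∀ w : ℂ, HasSum (fun k : ℕ => (k.factorial : ℂ)⁻¹ * w ^ k) (Complex.exp w) := by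
    intro w
    rw [Complex.exp_eq_exp_ℂ]
    exact NormedSpace.exp_series_hasSum_exp' (𝕂 := ℂ) w
  have h : HasSum (fun k : ℕ => ((k.factorial : ℂ)⁻¹) • (z • N) ^ k)
      (Complex.exp z • ((1 / 2 : ℂ) • (1 + N)) + Complex.exp (-z) • ((1 / 2 : ℂ) • (1 - N))) := by
    refine (((hc z).smul_const ((1 / 2 : ℂ) • (1 + N))).add
      ((hc (-z)).smul_const ((1 / 2 : ℂ) • (1 - N)))).congr_fun fun k => ?_
    rw [smul_pow, hpow, neg_pow z k]
    module
  rw [(Matrix.hasSum_exp (z • N)).unique h, Complex.cosh, Complex.sinh]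
  module

theorem Matrix.exp_of_mul_self_eq_zero {n : Type*} [Fintype n] [DecidableEq n]
    {A : Matrix n n ℂ} (hA : A * A = 0) : exp A = 1 + A := by
  rw [NormedSpace.exp_eq_tsum_rat]
  beta_reduce
  rw [tsum_eq_sum (s := Finset.range 2)]
  · simp [Finset.sum_range_succ]
  · intro k hk
    obtain ⟨j, rfl⟩ := Nat.exists_eq_add_of_le (by simpa [Nat.succ_le_iff] using hk : 2 ≤ k)
    simp [pow_add, sq, hA]

theorem Matrix.det_exp_fin_two_of_trace_eq_zero {A : Matrix (Fin 2) (Fin 2) ℂ}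
    (hA : A.trace = 0) : (exp A).det = 1 := by
  -- By Cayley-Hamilton `A * A` is the scalar `-det A`, so `A` is nilpotent or a multiple of an
  -- involution.
  have h11 : A 1 1 = -A 0 0 := by
    rw [Matrix.trace_fin_two] at hA
    linear_combination hA
  obtain ⟨d, hd⟩ := IsAlgClosed.exists_pow_nat_eq (-A.det) two_pos
  rw [Matrix.det_fin_two, h11] at hd
  rcases eq_or_ne d 0 with rfl | hd0
  · rw [Matrix.exp_of_mul_self_eq_zero]
    · simp [Matrix.det_fin_two, h11]
      linear_combination hd
    · ext i j
      fin_cases i <;> fin_cases j <;> simp [Matrix.mul_apply, h11]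
      · linear_combination -hd
      · ring
      · ring
      · linear_combination -hd
  · have hN : (d⁻¹ • A) * (d⁻¹ • A) = 1 := by
      have h2 : d⁻¹ * d⁻¹ * d ^ 2 = 1 := by field_simp
      ext i j
      fin_cases i <;> fin_cases j <;> simp [Matrix.mul_apply, h11]
      · linear_combination h2 - d⁻¹ * d⁻¹ * hd
      · ring
      · ring
      · linear_combination h2 - d⁻¹ * d⁻¹ * hd
    have h1 : A = d • (d⁻¹ • A) := by rw [smul_smul, mul_inv_cancel₀ hd0, one_smul]
    rw [h1, Matrix.exp_smul_of_mul_self_eq_one hN]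
    have h2 : d⁻¹ * d⁻¹ * d ^ 2 = 1 := by field_simp
    simp [Matrix.det_fin_two, h11]
    linear_combination Complex.cosh_sq_sub_sinh_sq d + Complex.sinh d ^ 2 * (d⁻¹ * d⁻¹ * hd - h2)

/-! ### Pairs of `2 × 2` matrices as `4 × 4` matrices -/

/-- The embedding of pairs of `2 × 2` matrices as the commutant of `[0 1; -1 0]`. The two factors
act on its eigenspaces for the eigenvalues `i` and `-i`. -/
noncomputable def blockEmbedding : Matrix (Fin 2) (Fin 2) ℂ × Matrix (Fin 2) (Fin 2) ℂ →+*
    Matrix (Fin 2 ⊕ Fin 2) (Fin 2 ⊕ Fin 2) ℂ where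
  toFun p := Matrix.fromBlocks ((1 / 2 : ℂ) • (p.1 + p.2)) (-(Complex.I / 2) • (p.1 - p.2))
    ((Complex.I / 2) • (p.1 - p.2)) ((1 / 2 : ℂ) • (p.1 + p.2))
  map_one' := by
    rw [← Matrix.fromBlocks_one]
    congr 1 <;> simp <;> module
  map_zero' := by simp
  map_add' p q := by
    rw [Matrix.fromBlocks_add]
    congr 1 <;> simp only [Prod.fst_add, Prod.snd_add] <;> module
  map_mul' p q := by
    rw [Matrix.fromBlocks_multiply]
    have hI : Complex.I * Complex.I = -1 := Complex.I_mul_I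
    congr 1 <;>
    · simp only [Prod.fst_mul, Prod.snd_mul, smul_mul_smul_comm, mul_add, add_mul, mul_sub,
        sub_mul]
      match_scalars <;> grind

theorem continuous_blockEmbedding : Continuous blockEmbedding := by
  change Continuous fun p : Matrix (Fin 2) (Fin 2) ℂ × Matrix (Fin 2) (Fin 2) ℂ =>
    Matrix.fromBlocks ((1 / 2 : ℂ) • (p.1 + p.2)) (-(Complex.I / 2) • (p.1 - p.2))
      ((Complex.I / 2) • (p.1 - p.2)) ((1 / 2 : ℂ) • (p.1 + p.2))
  exact Continuous.matrix_fromBlocks (by fun_prop) (by fun_prop) (by fun_prop) (by fun_prop)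

theorem blockEmbedding_apply (P Q : Matrix (Fin 2) (Fin 2) ℂ) :
    blockEmbedding (P, Q) = Matrix.fromBlocks ((1 / 2 : ℂ) • (P + Q))
      (-(Complex.I / 2) • (P - Q)) ((Complex.I / 2) • (P - Q)) ((1 / 2 : ℂ) • (P + Q)) :=
  rfl

theorem blockEmbedding_self (P : Matrix (Fin 2) (Fin 2) ℂ) :
    blockEmbedding (P, P) = Matrix.fromBlocks P 0 0 P := by
  rw [blockEmbedding_apply, ← two_smul ℂ P, smul_smul]
  simp

theorem blockEmbedding_smul (c : ℂ) (p : Matrix (Fin 2) (Fin 2) ℂ × Matrix (Fin 2) (Fin 2) ℂ) :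
    blockEmbedding (c • p) = c • blockEmbedding p := by
  obtain ⟨P, Q⟩ := p
  rw [Prod.smul_mk, blockEmbedding_apply, blockEmbedding_apply, Matrix.fromBlocks_smul]
  congr 1 <;> module

theorem conjTranspose_blockEmbedding (P Q : Matrix (Fin 2) (Fin 2) ℂ) :
    (blockEmbedding (P, Q)).conjTranspose =
      blockEmbedding (P.conjTranspose, Q.conjTranspose) := by
  rw [blockEmbedding_apply, blockEmbedding_apply, Matrix.fromBlocks_conjTranspose]
  congr 1 <;> simp [Matrix.conjTranspose_smul] <;> module

/-- The matrices `[1 1; i -i]` and `[1 -i; 1 i]`, inverse to each other up to a factor of two,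
block-diagonalise the embedding. -/
theorem det_blockEmbedding (P Q : Matrix (Fin 2) (Fin 2) ℂ) :
    (blockEmbedding (P, Q)).det = P.det * Q.det := by
  let W : Matrix (Fin 2 ⊕ Fin 2) (Fin 2 ⊕ Fin 2) ℂ :=
    Matrix.fromBlocks 1 1 (Complex.I • 1) (-Complex.I • 1)
  have h1 : blockEmbedding (P, Q) * W = W * Matrix.fromBlocks P 0 0 Q := by
    rw [blockEmbedding_apply, Matrix.fromBlocks_multiply, Matrix.fromBlocks_multiply]
    have hI : Complex.I * Complex.I = -1 := Complex.I_mul_I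
    congr 1 <;> simp [smul_smul, smul_sub, smul_add] <;> match_scalars <;> simp <;> grind
  have h2 : W * Matrix.fromBlocks 1 (-Complex.I • 1) 1 (Complex.I • 1) = (2 : ℂ) • 1 := by
    rw [Matrix.fromBlocks_multiply, ← Matrix.fromBlocks_one, Matrix.fromBlocks_smul]
    congr 1 <;> simp [smul_smul, two_smul]
  have hW : W.det ≠ 0 := by
    intro h
    have := congrArg Matrix.det h2
    rw [Matrix.det_mul, h, Matrix.det_smul] at this
    norm_num at this
  have h3 := congrArg Matrix.det h1
  rw [Matrix.det_mul, Matrix.det_mul, Matrix.det_fromBlocks_zero₂₁] at h3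
  exact mul_right_cancel₀ hW (by rw [h3, mul_comm])

/-- The first component of the inverse of `blockEmbedding` on its image, extended to all matrices. -/
noncomputable def blockFst (M : Matrix (Fin 2 ⊕ Fin 2) (Fin 2 ⊕ Fin 2) ℂ) : Matrix (Fin 2) (Fin 2) ℂ :=
  M.toBlocks₁₁ + Complex.I • M.toBlocks₁₂

/-- The second component of the inverse of `blockEmbedding` on its image, extended to all matrices. -/
noncomputable def blockSnd (M : Matrix (Fin 2 ⊕ Fin 2) (Fin 2 ⊕ Fin 2) ℂ) : Matrix (Fin 2) (Fin 2) ℂ :=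
  M.toBlocks₁₁ - Complex.I • M.toBlocks₁₂

theorem continuous_blockFst : Continuous blockFst := by
  refine continuous_matrix fun i j => ?_
  simp only [blockFst, Matrix.add_apply, Matrix.smul_apply, Matrix.toBlocks₁₁, Matrix.toBlocks₁₂,
    Matrix.of_apply]
  fun_prop

theorem continuous_blockSnd : Continuous blockSnd := by
  refine continuous_matrix fun i j => ?_
  simp only [blockSnd, Matrix.sub_apply, Matrix.smul_apply, Matrix.toBlocks₁₁, Matrix.toBlocks₁₂,
    Matrix.of_apply]
  fun_prop

@[simp]
theorem blockFst_blockEmbedding (P Q : Matrix (Fin 2) (Fin 2) ℂ) :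
    blockFst (blockEmbedding (P, Q)) = P := by
  rw [blockEmbedding_apply, blockFst, Matrix.toBlocks_fromBlocks₁₁, Matrix.toBlocks_fromBlocks₁₂,
    smul_smul, show Complex.I * -(Complex.I / 2) = 1 / 2 by
      linear_combination (-1 / 2) * Complex.I_mul_I]
  module

@[simp]
theorem blockSnd_blockEmbedding (P Q : Matrix (Fin 2) (Fin 2) ℂ) :
    blockSnd (blockEmbedding (P, Q)) = Q := by
  rw [blockEmbedding_apply, blockSnd, Matrix.toBlocks_fromBlocks₁₁, Matrix.toBlocks_fromBlocks₁₂,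
    smul_smul, show Complex.I * -(Complex.I / 2) = 1 / 2 by
      linear_combination (-1 / 2) * Complex.I_mul_I]
  module

/-! ### Exponential coordinates and the two Lie algebras -/

/-- The traceless Hermitian matrix `[x z; conj z -x]`; in terms of Pauli matrices it is
`Re z • σ₁ - Im z • σ₂ + x • σ₃`. -/
noncomputable def tracelessHermitian (v : ℝ × ℂ) : Matrix (Fin 2) (Fin 2) ℂ :=
  !![(v.1 : ℂ), v.2; conj v.2, -(v.1 : ℂ)]

theorem tracelessHermitian_smul (r : ℝ) (v : ℝ × ℂ) :
    tracelessHermitian (r • v) = (r : ℂ) • tracelessHermitian v := by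
  ext i j
  fin_cases i <;> fin_cases j <;> simp [tracelessHermitian]

theorem tracelessHermitian_mul_self {v : ℝ × ℂ} (hv : v.1 ^ 2 + Complex.normSq v.2 = 1) :
    tracelessHermitian v * tracelessHermitian v = 1 := by
  have h : (v.1 : ℂ) ^ 2 + v.2 * conj v.2 = 1 := by
    rw [Complex.mul_conj]
    exact_mod_cast hv
  ext i j
  fin_cases i <;> fin_cases j <;> simp [tracelessHermitian, Matrix.mul_apply]
  · linear_combination h
  · ring
  · ring
  · linear_combination h

/-- Polar coordinates on the three-dimensional space `ℝ × ℂ`. -/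
theorem exists_eq_smul_unit {r : ℝ} (hr : 0 ≤ r) {v : ℝ × ℂ}
    (hv : v.1 ^ 2 + Complex.normSq v.2 = r ^ 2) :
    ∃ n : ℝ × ℂ, n.1 ^ 2 + Complex.normSq n.2 = 1 ∧ v = r • n := by
  rcases hr.eq_or_lt with rfl | hr
  · refine ⟨(1, 0), by simp, ?_⟩
    have h1 := sq_nonneg v.1
    have h2 := Complex.normSq_nonneg v.2
    ext1
    · simpa using (by nlinarith : v.1 ^ 2 = 0)
    · simpa using (by nlinarith : Complex.normSq v.2 = 0)
  · refine ⟨r⁻¹ • v, ?_, by rw [smul_smul, mul_inv_cancel₀ hr.ne', one_smul]⟩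
    have : (r⁻¹ • v).2 = ((r⁻¹ : ℝ) : ℂ) * v.2 := by simp
    rw [this, Complex.normSq_mul, Complex.normSq_ofReal]
    simp only [Prod.smul_fst, smul_eq_mul]
    field_simp
    linarith

/-- Every element of `SU(2)` is `c + i H` with `H` traceless Hermitian and `c ^ 2 + H ^ 2 = 1`. -/
theorem exists_eq_of_mem_specialUnitaryGroup {U : Matrix (Fin 2) (Fin 2) ℂ}
    (hU : U ∈ Matrix.specialUnitaryGroup (Fin 2) ℂ) :
    ∃ (c : ℝ) (v : ℝ × ℂ), c ^ 2 + (v.1 ^ 2 + Complex.normSq v.2) = 1 ∧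
      U = (c : ℂ) • (1 : Matrix (Fin 2) (Fin 2) ℂ) + Complex.I • tracelessHermitian v := by
  obtain ⟨hU, hdet⟩ := Matrix.mem_specialUnitaryGroup_iff.1 hU
  have hadj : star U = U.adjugate := by
    have h1 := Matrix.mem_unitaryGroup_iff'.1 hU
    have h2 : U * U.adjugate = 1 := by rw [Matrix.mul_adjugate, hdet, one_smul]
    exact left_inv_eq_right_inv h1 h2
  rw [Matrix.adjugate_fin_two] at hadj
  have h00 : conj (U 0 0) = U 1 1 := by simpa using congrFun (congrFun hadj 0) 0
  have h10 : conj (U 0 1) = -U 1 0 := by simpa using congrFun (congrFun hadj 1) 0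
  rw [Matrix.det_fin_two] at hdet
  have hre := congrArg Complex.re h00
  have him := congrArg Complex.im h00
  have hre' := congrArg Complex.re h10
  have him' := congrArg Complex.im h10
  simp only [Complex.conj_re, Complex.conj_im, Complex.neg_re, Complex.neg_im] at hre him hre' him'
  refine ⟨(U 0 0).re, ((U 0 0).im, -Complex.I * U 0 1), ?_, ?_⟩
  · have := congrArg Complex.re hdet
    simp [Complex.normSq_apply] at this ⊢
    rw [← hre, ← him] at this
    have e1 : (U 1 0).re = -(U 0 1).re := by linarith
    have e2 : (U 1 0).im = (U 0 1).im := by linarith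
    rw [e1, e2] at this
    linarith
  · ext i j
    fin_cases i <;> fin_cases j <;> apply Complex.ext <;> simp [tracelessHermitian] <;> linarith

/-- The exponential map of `SU(2)` is surjective. -/
theorem exists_exp_eq_of_mem_specialUnitaryGroup {U : Matrix (Fin 2) (Fin 2) ℂ}
    (hU : U ∈ Matrix.specialUnitaryGroup (Fin 2) ℂ) :
    ∃ v : ℝ × ℂ, U = exp (Complex.I • tracelessHermitian v) := by
  obtain ⟨c, v, hcv, rfl⟩ := exists_eq_of_mem_specialUnitaryGroup hU
  have hv0 : 0 ≤ v.1 ^ 2 + Complex.normSq v.2 :=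
    add_nonneg (sq_nonneg _) (Complex.normSq_nonneg _)
  have hr : v.1 ^ 2 + Complex.normSq v.2 = Real.sqrt (1 - c ^ 2) ^ 2 := by
    rw [Real.sq_sqrt] <;> linarith
  obtain ⟨n, hn, hvn⟩ := exists_eq_smul_unit (Real.sqrt_nonneg _) hr
  refine ⟨Real.arccos c • n, ?_⟩
  rw [tracelessHermitian_smul, smul_smul, mul_comm,
    Matrix.exp_smul_of_mul_self_eq_one (tracelessHermitian_mul_self hn),
    Complex.cosh_mul_I, Complex.sinh_mul_I, ← Complex.ofReal_cos, ← Complex.ofReal_sin,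
    Real.cos_arccos (by nlinarith) (by nlinarith), Real.sin_arccos, hvn, tracelessHermitian_smul,
    smul_smul, mul_comm Complex.I]

/-- The positive definite Hermitian matrix of determinant one with traceless part
`tracelessHermitian v`. -/
noncomputable def posHermitian (v : ℝ × ℂ) : Matrix (Fin 2) (Fin 2) ℂ :=
  (Real.sqrt (1 + (v.1 ^ 2 + Complex.normSq v.2)) : ℂ) • (1 : Matrix (Fin 2) (Fin 2) ℂ) +
    tracelessHermitian v

theorem continuous_posHermitian : Continuous posHermitian := by
  have h : Continuous Complex.normSq := Complex.continuous_normSq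
  refine continuous_matrix fun i j => ?_
  fin_cases i <;> fin_cases j <;> simp [posHermitian, tracelessHermitian] <;> fun_prop

/-- A traceless Hermitian `H` with `H ^ 2 = r ^ 2` is `sinh t • N` with `N ^ 2 = 1` and
`sinh t = r`, so that `√(1 + r ^ 2) ± H = cosh t ± sinh t • N = exp (±t • N)`. -/
theorem exists_exp_eq_posHermitian (v : ℝ × ℂ) :
    ∃ w : ℝ × ℂ, posHermitian v = exp (tracelessHermitian w) ∧
      posHermitian (-v) = exp (-tracelessHermitian w) := by
  have hv0 : 0 ≤ v.1 ^ 2 + Complex.normSq v.2 :=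
    add_nonneg (sq_nonneg _) (Complex.normSq_nonneg _)
  obtain ⟨n, hn, hvn⟩ := exists_eq_smul_unit (Real.sqrt_nonneg (v.1 ^ 2 + Complex.normSq v.2))
    (Real.sq_sqrt hv0).symm
  set r := Real.sqrt (v.1 ^ 2 + Complex.normSq v.2) with hr
  have hr2 : v.1 ^ 2 + Complex.normSq v.2 = r ^ 2 := (Real.sq_sqrt hv0).symm
  have hH := tracelessHermitian_mul_self hn
  have hneg : tracelessHermitian (-v) = -tracelessHermitian v := by
    simpa using tracelessHermitian_smul (-1) v
  refine ⟨Real.arsinh r • n, ?_, ?_⟩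
  · rw [tracelessHermitian_smul, Matrix.exp_smul_of_mul_self_eq_one hH, ← Complex.ofReal_cosh,
      ← Complex.ofReal_sinh, Real.sinh_arsinh, Real.cosh_arsinh, posHermitian, hr2, hvn,
      tracelessHermitian_smul]
  · rw [tracelessHermitian_smul, ← neg_smul, Matrix.exp_smul_of_mul_self_eq_one hH,
      Complex.cosh_neg, Complex.sinh_neg, ← Complex.ofReal_cosh,
      ← Complex.ofReal_sinh, Real.sinh_arsinh, Real.cosh_arsinh, posHermitian, hneg, hvn,
      tracelessHermitian_smul, neg_smul, ← hvn]
    simp [hr2]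

theorem tracelessHermitian_eq_sum (v : ℝ × ℂ) : tracelessHermitian v =
    (v.2.re : ℂ) • pauli 0 + (-v.2.im : ℂ) • pauli 1 + (v.1 : ℂ) • pauli 2 := by
  ext i j
  fin_cases i <;> fin_cases j <;> apply Complex.ext <;> simp [tracelessHermitian, pauli]

theorem genJ_eq (a : Fin 3) :
    genJ a = blockEmbedding ((1 / 2 : ℂ) • pauli a, (1 / 2 : ℂ) • pauli a) := by
  rw [blockEmbedding_self, genJ, Matrix.fromBlocks_smul]
  simp

theorem genK_eq (a : Fin 3) :
    genK a = blockEmbedding ((Complex.I / 2) • pauli a, -(Complex.I / 2) • pauli a) := by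
  rw [blockEmbedding_apply, genK, Matrix.fromBlocks_multiply, Matrix.fromBlocks_smul]
  have hI : Complex.I * Complex.I = -1 := Complex.I_mul_I
  congr 1 <;> simp <;> match_scalars <;> grind

theorem star_pauli (a : Fin 3) : (pauli a).conjTranspose = pauli a := by
  ext i j
  fin_cases a <;> fin_cases i <;> fin_cases j <;> simp [pauli]

theorem trace_pauli (a : Fin 3) : (pauli a).trace = 0 := by
  fin_cases a <;> simp [pauli, Matrix.trace_fin_two]

/-- The image under `blockEmbedding` of a real subspace closed under commutators. -/
def blockLieSubalgebra (p : Submodule ℝ (Matrix (Fin 2) (Fin 2) ℂ × Matrix (Fin 2) (Fin 2) ℂ))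
    (hp : ∀ x ∈ p, ∀ y ∈ p, x * y - y * x ∈ p) :
    LieSubalgebra ℝ (Matrix (Fin 2 ⊕ Fin 2) (Fin 2 ⊕ Fin 2) ℂ) where
  carrier := blockEmbedding '' p
  add_mem' := by
    rintro _ _ ⟨x, hx, rfl⟩ ⟨y, hy, rfl⟩
    exact ⟨x + y, p.add_mem hx hy, map_add _ _ _⟩
  zero_mem' := ⟨0, p.zero_mem, map_zero _⟩
  smul_mem' := by
    rintro c _ ⟨x, hx, rfl⟩
    exact ⟨c • x, p.smul_mem c hx, blockEmbedding_smul c x⟩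
  lie_mem' := by
    rintro _ _ ⟨x, hx, rfl⟩ ⟨y, hy, rfl⟩
    refine ⟨x * y - y * x, hp x hx y hy, ?_⟩
    rw [map_sub, map_mul, map_mul]
    rfl

/-- `𝔰𝔲(2) × 𝔰𝔲(2)`. -/
def su2Pairs : Submodule ℝ (Matrix (Fin 2) (Fin 2) ℂ × Matrix (Fin 2) (Fin 2) ℂ) where
  carrier := {x | (x.1.conjTranspose = -x.1 ∧ x.1.trace = 0) ∧
    (x.2.conjTranspose = -x.2 ∧ x.2.trace = 0)}
  add_mem' := by
    rintro x y ⟨⟨h1, h2⟩, h3, h4⟩ ⟨⟨h1', h2'⟩, h3', h4'⟩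
    simp [Matrix.conjTranspose_add, h1, h2, h3, h4, h1', h2', h3', h4', add_comm]
  zero_mem' := by simp
  smul_mem' := by
    rintro c x ⟨⟨h1, h2⟩, h3, h4⟩
    simp [Matrix.conjTranspose_smul, h1, h2, h3, h4]

/-- The graph of `X ↦ -Xᴴ` over `𝔰𝔩(2, ℂ)`. -/
def sl2Graph : Submodule ℝ (Matrix (Fin 2) (Fin 2) ℂ × Matrix (Fin 2) (Fin 2) ℂ) where
  carrier := {x | x.2 = -x.1.conjTranspose ∧ x.1.trace = 0}
  add_mem' := by
    rintro x y ⟨h1, h2⟩ ⟨h1', h2'⟩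
    simp [Matrix.conjTranspose_add, h1, h2, h1', h2', add_comm]
  zero_mem' := by simp
  smul_mem' := by
    rintro c x ⟨h1, h2⟩
    simp [Matrix.conjTranspose_smul, h1, h2]

theorem compactLieAlg_subset :
    (compactLieAlg : Set (Matrix (Fin 2 ⊕ Fin 2) (Fin 2 ⊕ Fin 2) ℂ)) ⊆
      blockEmbedding '' su2Pairs := by
  have hp : ∀ x ∈ su2Pairs, ∀ y ∈ su2Pairs, x * y - y * x ∈ su2Pairs := by
    rintro x ⟨⟨h1, h2⟩, h3, h4⟩ y ⟨⟨h1', h2'⟩, h3', h4'⟩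
    refine ⟨⟨?_, ?_⟩, ?_, ?_⟩
    · simp [Matrix.conjTranspose_mul, h1, h1']
    · simp [Matrix.trace_mul_comm x.1 y.1]
    · simp [Matrix.conjTranspose_mul, h3, h3']
    · simp [Matrix.trace_mul_comm x.2 y.2]
  have : compactLieAlg ≤ blockLieSubalgebra su2Pairs hp := by
    refine LieSubalgebra.lieSpan_le.2 ?_
    rintro _ (⟨a, rfl⟩ | ⟨a, rfl⟩)
    · refine ⟨_, ?_, (by rw [genJ_eq, ← blockEmbedding_smul] : _ = Complex.I • genJ a)⟩
      simp [su2Pairs, Matrix.conjTranspose_smul, star_pauli, trace_pauli]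
    · refine ⟨_, ?_, (genK_eq a).symm⟩
      simp [su2Pairs, Matrix.conjTranspose_smul, star_pauli, trace_pauli, neg_div]
  exact this

theorem lorentzLieAlg_subset :
    (lorentzLieAlg : Set (Matrix (Fin 2 ⊕ Fin 2) (Fin 2 ⊕ Fin 2) ℂ)) ⊆
      blockEmbedding '' sl2Graph := by
  have hp : ∀ x ∈ sl2Graph, ∀ y ∈ sl2Graph, x * y - y * x ∈ sl2Graph := by
    rintro x ⟨h1, h2⟩ y ⟨h1', h2'⟩
    refine ⟨?_, ?_⟩
    · simp [Matrix.conjTranspose_mul, h1, h1']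
    · simp [Matrix.trace_mul_comm x.1 y.1]
  have : lorentzLieAlg ≤ blockLieSubalgebra sl2Graph hp := by
    refine LieSubalgebra.lieSpan_le.2 ?_
    rintro _ (⟨a, rfl⟩ | ⟨a, rfl⟩)
    · refine ⟨_, ?_, (by rw [genJ_eq, ← blockEmbedding_smul] : _ = Complex.I • genJ a)⟩
      simp [sl2Graph, Matrix.conjTranspose_smul, star_pauli, trace_pauli]
    · refine ⟨_, ?_, (by rw [genK_eq, ← blockEmbedding_smul] : _ = Complex.I • genK a)⟩
      simp [sl2Graph, Matrix.conjTranspose_smul, star_pauli, trace_pauli, smul_smul]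
      module
  exact this

theorem sum_smul_mem_lieSpan (s : Set (Matrix (Fin 2 ⊕ Fin 2) (Fin 2 ⊕ Fin 2) ℂ))
    (X : Fin 3 → Matrix (Fin 2 ⊕ Fin 2) (Fin 2 ⊕ Fin 2) ℂ) (hX : ∀ a, X a ∈ s) (c : Fin 3 → ℝ) :
    ∑ a, (c a : ℂ) • X a ∈ LieSubalgebra.lieSpan ℝ _ s :=
  sum_mem fun a _ => (LieSubalgebra.lieSpan ℝ _ s).smul_mem (c a)
    (LieSubalgebra.subset_lieSpan (hX a))

theorem blockEmbedding_I_smul_eq_sum (v : ℝ × ℂ) :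
    blockEmbedding (Complex.I • tracelessHermitian v, Complex.I • tracelessHermitian v) =
      ∑ a, ((![2 * v.2.re, -2 * v.2.im, 2 * v.1] a : ℝ) : ℂ) • (Complex.I • genJ a) := by
  simp only [genJ_eq, ← blockEmbedding_smul, ← map_sum, Fin.sum_univ_three,
    tracelessHermitian_eq_sum]
  congr 1
  ext1 <;> simp <;> module

theorem blockEmbedding_I_smul_neg_eq_sum (v : ℝ × ℂ) :
    blockEmbedding (Complex.I • tracelessHermitian v, -(Complex.I • tracelessHermitian v)) =
      ∑ a, ((![2 * v.2.re, -2 * v.2.im, 2 * v.1] a : ℝ) : ℂ) • genK a := by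
  simp only [genK_eq, ← blockEmbedding_smul, ← map_sum, Fin.sum_univ_three,
    tracelessHermitian_eq_sum]
  congr 1
  ext1 <;> simp <;> module

theorem blockEmbedding_neg_eq_sum (v : ℝ × ℂ) :
    blockEmbedding (tracelessHermitian v, -tracelessHermitian v) =
      ∑ a, ((![-2 * v.2.re, 2 * v.2.im, -2 * v.1] a : ℝ) : ℂ) • (Complex.I • genK a) := by
  simp only [genK_eq, ← blockEmbedding_smul, ← map_sum, Fin.sum_univ_three,
    tracelessHermitian_eq_sum]
  congr 1
  have hI : Complex.I * Complex.I = -1 := Complex.I_mul_I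
  ext1 <;> simp <;> match_scalars <;> simp only [Complex.coe_algebraMap] <;> grind

theorem blockEmbedding_mem_compactLieAlg (v w : ℝ × ℂ) :
    blockEmbedding (Complex.I • tracelessHermitian v, Complex.I • tracelessHermitian w) ∈
      compactLieAlg := by
  have hJ : ∀ u, blockEmbedding (Complex.I • tracelessHermitian u,
      Complex.I • tracelessHermitian u) ∈ compactLieAlg := fun u => by
    rw [blockEmbedding_I_smul_eq_sum]
    exact sum_smul_mem_lieSpan _ _ (fun a => Or.inl ⟨a, rfl⟩) _
  have hK : ∀ u, blockEmbedding (Complex.I • tracelessHermitian u,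
      -(Complex.I • tracelessHermitian u)) ∈ compactLieAlg := fun u => by
    rw [blockEmbedding_I_smul_neg_eq_sum]
    exact sum_smul_mem_lieSpan _ _ (fun a => Or.inr ⟨a, rfl⟩) _
  -- `(X, Y)` is half the sum of `(X, X)`, `(X, -X)`, `(Y, Y)` and `-(Y, -Y)`.
  have := compactLieAlg.smul_mem (1 / 2 : ℝ) (compactLieAlg.sub_mem
    (compactLieAlg.add_mem (compactLieAlg.add_mem (hJ v) (hK v)) (hJ w)) (hK w))
  convert this using 1
  have e : ∀ M : Matrix (Fin 2 ⊕ Fin 2) (Fin 2 ⊕ Fin 2) ℂ,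
      (1 / 2 : ℝ) • M = ((1 / 2 : ℝ) : ℂ) • M := fun M => (Complex.coe_smul _ M).symm
  rw [e, ← map_add, ← map_add, ← map_sub, ← blockEmbedding_smul]
  congr 1
  ext1 <;> simp <;> module

theorem blockEmbedding_I_smul_mem_lorentzLieAlg (v : ℝ × ℂ) :
    blockEmbedding (Complex.I • tracelessHermitian v, Complex.I • tracelessHermitian v) ∈
      lorentzLieAlg := by
  rw [blockEmbedding_I_smul_eq_sum]
  exact sum_smul_mem_lieSpan _ _ (fun a => Or.inl ⟨a, rfl⟩) _

theorem blockEmbedding_neg_mem_lorentzLieAlg (v : ℝ × ℂ) :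
    blockEmbedding (tracelessHermitian v, -tracelessHermitian v) ∈ lorentzLieAlg := by
  rw [blockEmbedding_neg_eq_sum]
  exact sum_smul_mem_lieSpan _ _ (fun a => Or.inr ⟨a, rfl⟩) _

/-! ### The compact group -/

theorem Matrix.isCompact_specialUnitaryGroup (n : Type*) [Fintype n] [DecidableEq n] :
    IsCompact (Matrix.specialUnitaryGroup n ℂ : Set (Matrix n n ℂ)) := by
  have hK : IsCompact (Set.univ.pi fun _ : n => Set.univ.pi fun _ : n =>
      Metric.closedBall (0 : ℂ) 1) :=
    isCompact_univ_pi fun _ => isCompact_univ_pi fun _ => isCompact_closedBall _ _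
  refine hK.of_isClosed_subset ?_ fun U hU i _ j _ => ?_
  · have : (Matrix.specialUnitaryGroup n ℂ : Set (Matrix n n ℂ)) =
        {U | U * star U = 1} ∩ {U | U.det = 1} := by
      ext U
      simp [Matrix.mem_specialUnitaryGroup_iff, Matrix.mem_unitaryGroup_iff]
    rw [this]
    exact (isClosed_eq (by fun_prop) continuous_const).inter
      (isClosed_eq (by fun_prop) continuous_const)
  · simpa using entry_norm_bound_of_unitary hU.1 i j

/-- A quotient `Γ ⧸ H` is simply connected if an `H`-invariant map `φ` to a simply connected space
admits a section `s` that recovers every element of `Γ` modulo `H`. -/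
theorem simplyConnectedSpace_quotient {Γ Y : Type*} [Group Γ] [TopologicalSpace Γ]
    [TopologicalSpace Y] [SimplyConnectedSpace Y] (H : Subgroup Γ) {φ : Γ → Y} (hφ : Continuous φ)
    (hφH : ∀ a, ∀ h ∈ H, φ (a * h) = φ a) {s : Y → Γ} (hs : Continuous s)
    (hsφ : ∀ a, a⁻¹ * s (φ a) ∈ H) : SimplyConnectedSpace (Γ ⧸ H) := by
  have hlift : ∀ a b : Γ, QuotientGroup.leftRel H a b → φ a = φ b := fun a b hab => by
    rw [QuotientGroup.leftRel_apply] at hab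
    simpa using (hφH a _ hab).symm
  refine SimplyConnectedSpace.of_leftInverse (f := fun x => Quotient.lift φ hlift x)
    (g := fun y => (s y : Γ ⧸ H)) (hφ.quotient_lift hlift)
    (QuotientGroup.continuous_mk.comp hs) fun x => ?_
  induction x using QuotientGroup.induction_on with
  | H a => exact (QuotientGroup.eq.2 (hsφ a)).symm

/-- The homomorphism `SU(2) × SU(2) → GL(4, ℂ)` given by `blockEmbedding`. -/
noncomputable def compactHom :
    Matrix.specialUnitaryGroup (Fin 2) ℂ × Matrix.specialUnitaryGroup (Fin 2) ℂ →*
      Matrix.GeneralLinearGroup (Fin 2 ⊕ Fin 2) ℂ :=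
  MonoidHom.toHomUnits (blockEmbedding.toMonoidHom.comp
    ((Matrix.specialUnitaryGroup (Fin 2) ℂ).subtype.prodMap
      (Matrix.specialUnitaryGroup (Fin 2) ℂ).subtype))

theorem coe_compactHom
    (p : Matrix.specialUnitaryGroup (Fin 2) ℂ × Matrix.specialUnitaryGroup (Fin 2) ℂ) :
    (compactHom p : Matrix (Fin 2 ⊕ Fin 2) (Fin 2 ⊕ Fin 2) ℂ) = blockEmbedding (p.1, p.2) :=
  rfl

theorem coe_diracRep (U : Matrix.specialUnitaryGroup (Fin 2) ℂ) :
    (diracRep U : Matrix (Fin 2 ⊕ Fin 2) (Fin 2 ⊕ Fin 2) ℂ) = Matrix.fromBlocks ↑U 0 0 ↑U :=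
  rfl

theorem compactHom_self (U : Matrix.specialUnitaryGroup (Fin 2) ℂ) :
    compactHom (U, U) = diracRep U := by
  ext1
  rw [coe_compactHom, coe_diracRep, blockEmbedding_self]

theorem continuous_compactHom : Continuous compactHom := by
  have h : Continuous fun p : Matrix.specialUnitaryGroup (Fin 2) ℂ ×
      Matrix.specialUnitaryGroup (Fin 2) ℂ =>
        (blockEmbedding (p.1, p.2) : Matrix (Fin 2 ⊕ Fin 2) (Fin 2 ⊕ Fin 2) ℂ) :=
    continuous_blockEmbedding.comp (by fun_prop)
  refine Units.continuous_iff.2 ⟨h, ?_⟩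
  have h' : Continuous fun p : Matrix.specialUnitaryGroup (Fin 2) ℂ ×
      Matrix.specialUnitaryGroup (Fin 2) ℂ =>
        (blockEmbedding (star p.1.1, star p.2.1) : Matrix (Fin 2 ⊕ Fin 2) (Fin 2 ⊕ Fin 2) ℂ) :=
    continuous_blockEmbedding.comp (by fun_prop)
  convert h' using 2 with p
  rw [← map_inv]
  rfl

theorem exp_mem_specialUnitaryGroup {X : Matrix (Fin 2) (Fin 2) ℂ}
    (hX : X.conjTranspose = -X) (htr : X.trace = 0) :
    exp X ∈ Matrix.specialUnitaryGroup (Fin 2) ℂ := by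
  refine Matrix.mem_specialUnitaryGroup_iff.2
    ⟨Matrix.mem_unitaryGroup_iff'.2 ?_, Matrix.det_exp_fin_two_of_trace_eq_zero htr⟩
  rw [Matrix.star_eq_conjTranspose, ← Matrix.exp_conjTranspose, hX,
    ← Matrix.exp_add_of_commute _ _ (Commute.neg_left (Commute.refl X))]
  simp

theorem exp_blockEmbedding (X Y : Matrix (Fin 2) (Fin 2) ℂ) :
    exp (blockEmbedding (X, Y)) = blockEmbedding (exp X, exp Y) :=
  Matrix.map_exp_prod blockEmbedding continuous_blockEmbedding X Y

/-- The compact group is all of `SU(2) × SU(2)`. -/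
theorem compactG_eq_range : compactG = compactHom.range := by
  apply le_antisymm
  · refine (Subgroup.closure_le _).2 ?_
    rintro u ⟨X, hX, hu⟩
    obtain ⟨⟨x, y⟩, ⟨⟨hx, hx'⟩, hy, hy'⟩, rfl⟩ := compactLieAlg_subset hX
    refine ⟨(⟨exp x, exp_mem_specialUnitaryGroup hx hx'⟩,
      ⟨exp y, exp_mem_specialUnitaryGroup hy hy'⟩), ?_⟩
    ext1
    rw [hu, coe_compactHom, exp_blockEmbedding]
  · rintro _ ⟨⟨⟨U, hU⟩, ⟨V, hV⟩⟩, rfl⟩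
    obtain ⟨v, rfl⟩ := exists_exp_eq_of_mem_specialUnitaryGroup hU
    obtain ⟨w, rfl⟩ := exists_exp_eq_of_mem_specialUnitaryGroup hV
    exact Subgroup.subset_closure ⟨_, blockEmbedding_mem_compactLieAlg v w,
      (exp_blockEmbedding _ _).symm⟩

theorem compactG_le_specialUnitaryGroup {u : Matrix.GeneralLinearGroup (Fin 2 ⊕ Fin 2) ℂ}
    (hu : u ∈ compactG) : (u : Matrix (Fin 2 ⊕ Fin 2) (Fin 2 ⊕ Fin 2) ℂ) ∈
      Matrix.specialUnitaryGroup (Fin 2 ⊕ Fin 2) ℂ := by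
  rw [compactG_eq_range] at hu
  obtain ⟨⟨U, V⟩, rfl⟩ := hu
  have hU := Matrix.mem_specialUnitaryGroup_iff.1 U.2
  have hV := Matrix.mem_specialUnitaryGroup_iff.1 V.2
  rw [coe_compactHom]
  refine Matrix.mem_specialUnitaryGroup_iff.2 ⟨Matrix.mem_unitaryGroup_iff.2 ?_, ?_⟩
  · rw [Matrix.star_eq_conjTranspose, conjTranspose_blockEmbedding, ← map_mul, Prod.mk_mul_mk,
      ← Matrix.star_eq_conjTranspose, ← Matrix.star_eq_conjTranspose,
      Matrix.mem_unitaryGroup_iff.1 hU.1, Matrix.mem_unitaryGroup_iff.1 hV.1]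
    exact map_one blockEmbedding
  · rw [det_blockEmbedding, hU.2, hV.2, one_mul]

theorem isCompact_compactG :
    IsCompact (compactG : Set (Matrix.GeneralLinearGroup (Fin 2 ⊕ Fin 2) ℂ)) := by
  have : CompactSpace (Matrix.specialUnitaryGroup (Fin 2) ℂ) :=
    isCompact_iff_compactSpace.1 (Matrix.isCompact_specialUnitaryGroup (Fin 2))
  rw [compactG_eq_range, MonoidHom.coe_range]
  exact isCompact_range continuous_compactHom

theorem diracSU2_le_compactG : diracSU2 ≤ compactG := by
  rw [compactG_eq_range]
  rintro _ ⟨U, rfl⟩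
  exact ⟨(U, U), compactHom_self U⟩

theorem normSq_add_normSq_pos {w : ℂ × ℂ} (hw : w ∈ ({0}ᶜ : Set (ℂ × ℂ))) :
    0 < Complex.normSq w.1 + Complex.normSq w.2 := by
  have ha := Complex.normSq_nonneg w.1
  have hb := Complex.normSq_nonneg w.2
  refine lt_of_le_of_ne (add_nonneg ha hb) fun h => hw ?_
  exact Prod.ext (Complex.normSq_eq_zero.1 (by linarith)) (Complex.normSq_eq_zero.1 (by linarith))

/-- The element of `SU(2)` whose first column is the normalisation of a given nonzero vector. -/
noncomputable def su2OfColumn (w : ({0}ᶜ : Set (ℂ × ℂ))) :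
    Matrix.specialUnitaryGroup (Fin 2) ℂ :=
  ⟨((Real.sqrt (Complex.normSq w.1.1 + Complex.normSq w.1.2))⁻¹ : ℂ) •
    !![w.1.1, -conj w.1.2; w.1.2, conj w.1.1], by
    obtain ⟨⟨a, b⟩, hw⟩ := w
    have hpos := normSq_add_normSq_pos hw
    set k := Real.sqrt (Complex.normSq a + Complex.normSq b)
    have hk0 : (k : ℂ) ≠ 0 := by exact_mod_cast (Real.sqrt_pos.2 hpos).ne'
    have hk2 : (k : ℂ) ^ 2 = a * conj a + b * conj b := by
      rw [Complex.mul_conj, Complex.mul_conj]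
      exact_mod_cast Real.sq_sqrt hpos.le
    refine Matrix.mem_specialUnitaryGroup_iff.2 ⟨Matrix.mem_unitaryGroup_iff.2 ?_, ?_⟩
    · ext i j
      fin_cases i <;> fin_cases j <;> simp [Matrix.mul_apply] <;> field_simp
      · linear_combination -hk2
      · ring
      · ring
      · linear_combination -hk2
    · simp [Matrix.det_fin_two]
      field_simp
      linear_combination -hk2⟩

theorem continuous_su2OfColumn : Continuous su2OfColumn := by
  have hn : Continuous Complex.normSq := Complex.continuous_normSq
  have hk : Continuous fun w : ({0}ᶜ : Set (ℂ × ℂ)) =>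
      ((Real.sqrt (Complex.normSq w.1.1 + Complex.normSq w.1.2))⁻¹ : ℂ) := by
    refine Continuous.inv₀ (by fun_prop) fun w => ?_
    exact_mod_cast (Real.sqrt_pos.2 (normSq_add_normSq_pos w.2)).ne'
  refine Continuous.subtype_mk (hk.smul (continuous_matrix fun i j => ?_)) _
  fin_cases i <;> fin_cases j <;> simp <;> fun_prop

theorem column_ne_zero (U : Matrix.specialUnitaryGroup (Fin 2) ℂ) :
    ((U : Matrix (Fin 2) (Fin 2) ℂ) 0 0, (U : Matrix (Fin 2) (Fin 2) ℂ) 1 0) ∈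
      ({0}ᶜ : Set (ℂ × ℂ)) := by
  intro h
  have h1 : (U : Matrix (Fin 2) (Fin 2) ℂ) 0 0 = 0 := congrArg Prod.fst h
  have h2 : (U : Matrix (Fin 2) (Fin 2) ℂ) 1 0 = 0 := congrArg Prod.snd h
  have := (Matrix.mem_specialUnitaryGroup_iff.1 U.2).2
  rw [Matrix.det_fin_two, h1, h2] at this
  simp at this

theorem su2OfColumn_column (U : Matrix.specialUnitaryGroup (Fin 2) ℂ) :
    su2OfColumn ⟨_, column_ne_zero U⟩ = U := by
  obtain ⟨U, hU⟩ := U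
  obtain ⟨c, v, hcv, rfl⟩ := exists_eq_of_mem_specialUnitaryGroup hU
  apply Subtype.ext
  have h1 : Complex.normSq ((c : ℂ) + Complex.I * v.1) + Complex.normSq v.2 = 1 := by
    rw [← hcv, mul_comm, Complex.normSq_add_mul_I]
    ring
  ext i j
  fin_cases i <;> fin_cases j <;> simp [su2OfColumn, tracelessHermitian, h1]

/-- `(U, V) ↦ U V⁻¹` identifies the quotient of `SU(2) × SU(2)` by the diagonal with the
three-sphere, a retract of `ℂ² \ {0}`. -/
theorem simplyConnectedSpace_compact : SimplyConnectedSpace (homogeneousSpace compactG) := by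
  have hY : SimplyConnectedSpace ({0}ᶜ : Set (ℂ × ℂ)) :=
    isSimplyConnected_compl_zero (by simp)
  let m : Matrix (Fin 2 ⊕ Fin 2) (Fin 2 ⊕ Fin 2) ℂ → Matrix (Fin 2) (Fin 2) ℂ :=
    fun M => blockFst M * (blockSnd M).conjTranspose
  have hm : Continuous m :=
    continuous_blockFst.matrix_mul continuous_blockSnd.matrix_conjTranspose
  have hmU : ∀ U V, m (compactHom (U, V)) = (U * V⁻¹ : Matrix.specialUnitaryGroup (Fin 2) ℂ) := by
    intro U V
    simp only [m, coe_compactHom, blockFst_blockEmbedding, blockSnd_blockEmbedding]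
    rfl
  have hG : ∀ a : compactG, ∃ U V, (a : Matrix.GeneralLinearGroup (Fin 2 ⊕ Fin 2) ℂ) =
      compactHom (U, V) := fun a => by
    obtain ⟨⟨U, V⟩, h⟩ := compactG_eq_range.le a.2
    exact ⟨U, V, h.symm⟩
  have hne : ∀ a : compactG, ((m a.1) 0 0, (m a.1) 1 0) ∈ ({0}ᶜ : Set (ℂ × ℂ)) := fun a => by
    obtain ⟨U, V, h⟩ := hG a
    rw [h, hmU]
    exact column_ne_zero _
  have hs : ∀ w, compactHom (su2OfColumn w, 1) ∈ compactG := fun w => by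
    rw [compactG_eq_range]
    exact ⟨_, rfl⟩
  refine simplyConnectedSpace_quotient (diracSU2.subgroupOf compactG)
    (φ := fun a => (⟨_, hne a⟩ : ({0}ᶜ : Set (ℂ × ℂ))))
    (s := fun w => ⟨_, hs w⟩) ?_ ?_ ?_ ?_
  · have : Continuous fun a : compactG => m a.1 :=
      hm.comp (Units.continuous_val.comp continuous_subtype_val)
    exact Continuous.subtype_mk ((this.matrix_elem 0 0).prodMk (this.matrix_elem 1 0)) _
  · rintro a h hh
    obtain ⟨U, V, ha⟩ := hG a
    obtain ⟨W, hW⟩ := Subgroup.mem_subgroupOf.1 hh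
    have : m (a * h : compactG).1 = m a.1 := by
      rw [Subgroup.coe_mul, ha, ← hW, ← compactHom_self, ← map_mul, Prod.mk_mul_mk, hmU, hmU,
        mul_inv_rev, mul_assoc, mul_inv_cancel_left]
    simp only [this]
  · exact Continuous.subtype_mk
      (continuous_compactHom.comp (continuous_su2OfColumn.prodMk continuous_const)) _
  · intro a
    obtain ⟨U, V, ha⟩ := hG a
    have : su2OfColumn ⟨_, hne a⟩ = U * V⁻¹ := by
      rw [← su2OfColumn_column (U * V⁻¹)]
      simp only [ha, hmU]
    refine Subgroup.mem_subgroupOf.2 ⟨V⁻¹, ?_⟩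
    change diracRep V⁻¹ = (a : Matrix.GeneralLinearGroup (Fin 2 ⊕ Fin 2) ℂ)⁻¹ *
      compactHom (su2OfColumn ⟨_, hne a⟩, 1)
    rw [this, ha, ← map_inv, ← map_mul, Prod.inv_mk, Prod.mk_mul_mk, inv_mul_cancel_left, mul_one,
      compactHom_self]

/-! ### The Lorentz group -/

theorem trace_tracelessHermitian (v : ℝ × ℂ) : (tracelessHermitian v).trace = 0 := by
  simp [tracelessHermitian, Matrix.trace_fin_two]

theorem conjTranspose_posHermitian (v : ℝ × ℂ) :
    (posHermitian v).conjTranspose = posHermitian v := by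
  ext i j
  fin_cases i <;> fin_cases j <;> simp [posHermitian, tracelessHermitian]

theorem posHermitian_neg_mul (v : ℝ × ℂ) : posHermitian (-v) * posHermitian v = 1 := by
  obtain ⟨w, h1, h2⟩ := exists_exp_eq_posHermitian v
  rw [h1, h2, ← Matrix.exp_add_of_commute _ _ (Commute.refl (tracelessHermitian w)).neg_left]
  simp

/-- `posHermitian v` as an element of `SL(2, ℂ)`. -/
noncomputable def slPosHermitian (v : ℝ × ℂ) : SL(2, ℂ) :=
  ⟨posHermitian v, by
    obtain ⟨w, h1, -⟩ := exists_exp_eq_posHermitian v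
    rw [h1, Matrix.det_exp_fin_two_of_trace_eq_zero (trace_tracelessHermitian w)]⟩

theorem coe_slPosHermitian (v : ℝ × ℂ) :
    (slPosHermitian v : Matrix (Fin 2) (Fin 2) ℂ) = posHermitian v :=
  rfl

theorem slPosHermitian_inv (v : ℝ × ℂ) : (slPosHermitian v)⁻¹ = slPosHermitian (-v) := by
  refine inv_eq_of_mul_eq_one_left (Subtype.ext ?_)
  exact posHermitian_neg_mul v

/-- The homomorphism `P ↦ (P, (P⁻¹)ᴴ)`. -/
noncomputable def slGraphHom :
    SL(2, ℂ) →* Matrix (Fin 2) (Fin 2) ℂ × Matrix (Fin 2) (Fin 2) ℂ where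
  toFun P := (P, (P⁻¹ : SL(2, ℂ)).1.conjTranspose)
  map_one' := by simp
  map_mul' P Q := by
    rw [mul_inv_rev, Prod.mk_mul_mk, ← Matrix.conjTranspose_mul]
    rfl

/-- The homomorphism `SL(2, ℂ) → GL(4, ℂ)` sending `P` to the pair `(P, (P⁻¹)ᴴ)`. -/
noncomputable def lorentzHom : SL(2, ℂ) →* Matrix.GeneralLinearGroup (Fin 2 ⊕ Fin 2) ℂ :=
  MonoidHom.toHomUnits (blockEmbedding.toMonoidHom.comp slGraphHom)

theorem coe_lorentzHom (P : SL(2, ℂ)) :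
    (lorentzHom P : Matrix (Fin 2 ⊕ Fin 2) (Fin 2 ⊕ Fin 2) ℂ) =
      blockEmbedding (P.1, (P⁻¹ : SL(2, ℂ)).1.conjTranspose) :=
  rfl

/-- On unitary matrices `P ↦ (P, (P⁻¹)ᴴ)` is the diagonal map. -/
theorem lorentzHom_eq_diracRep {P : SL(2, ℂ)} (U : Matrix.specialUnitaryGroup (Fin 2) ℂ)
    (h : P.1 = U.1) : lorentzHom P = diracRep U := by
  have hinv : (P⁻¹ : SL(2, ℂ)).1 = star U.1 := by
    refine left_inv_eq_right_inv (a := P.1) ?_ ?_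
    · exact congrArg Subtype.val (inv_mul_cancel P)
    · rw [h]
      exact Matrix.mem_unitaryGroup_iff.1 (Matrix.mem_specialUnitaryGroup_iff.1 U.2).1
  ext1
  rw [coe_lorentzHom, coe_diracRep, hinv, Matrix.star_eq_conjTranspose,
    Matrix.conjTranspose_conjTranspose, h, blockEmbedding_self]

theorem diracSU2_le_lorentzG : diracSU2 ≤ lorentzG := by
  rintro _ ⟨⟨U, hU⟩, rfl⟩
  obtain ⟨v, rfl⟩ := exists_exp_eq_of_mem_specialUnitaryGroup hU
  refine Subgroup.subset_closure ⟨_, blockEmbedding_I_smul_mem_lorentzLieAlg v, ?_⟩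
  rw [exp_blockEmbedding, blockEmbedding_self, coe_diracRep]

theorem lorentzHom_slPosHermitian_mem (v : ℝ × ℂ) : lorentzHom (slPosHermitian v) ∈ lorentzG := by
  obtain ⟨w, h1, h2⟩ := exists_exp_eq_posHermitian v
  refine Subgroup.subset_closure ⟨_, blockEmbedding_neg_mem_lorentzLieAlg w, ?_⟩
  rw [exp_blockEmbedding, ← h1, ← h2, coe_lorentzHom, slPosHermitian_inv, coe_slPosHermitian,
    coe_slPosHermitian, conjTranspose_posHermitian]

theorem continuous_lorentzHom_slPosHermitian :
    Continuous fun v => lorentzHom (slPosHermitian v) := by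
  have hc : ∀ v, (lorentzHom (slPosHermitian v) : Matrix (Fin 2 ⊕ Fin 2) (Fin 2 ⊕ Fin 2) ℂ) =
      blockEmbedding (posHermitian v, posHermitian (-v)) := fun v => by
    rw [coe_lorentzHom, slPosHermitian_inv, coe_slPosHermitian, coe_slPosHermitian,
      conjTranspose_posHermitian]
  have hp := continuous_posHermitian
  refine Units.continuous_iff.2 ⟨?_, ?_⟩
  · refine (continuous_blockEmbedding.comp (hp.prodMk (hp.comp continuous_neg))).congr fun v => ?_
    exact (hc v).symm
  · refine (continuous_blockEmbedding.comp ((hp.comp continuous_neg).prodMk hp)).congr fun v => ?_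
    rw [← map_inv, slPosHermitian_inv, hc, neg_neg]
    rfl

theorem lorentzG_le_range : lorentzG ≤ lorentzHom.range := by
  refine (Subgroup.closure_le _).2 ?_
  rintro u ⟨X, hX, hu⟩
  obtain ⟨⟨x, y⟩, ⟨hy, hx⟩, rfl⟩ := lorentzLieAlg_subset hX
  obtain rfl : y = -x.conjTranspose := hy
  let P : SL(2, ℂ) := ⟨exp x, Matrix.det_exp_fin_two_of_trace_eq_zero hx⟩
  have hinv : (P⁻¹ : SL(2, ℂ)).1 = exp (-x) := by
    refine left_inv_eq_right_inv (a := P.1) (congrArg Subtype.val (inv_mul_cancel P)) ?_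
    change exp x * exp (-x) = 1
    rw [← Matrix.exp_add_of_commute _ _ (Commute.refl x).neg_right]
    simp
  refine ⟨P, ?_⟩
  ext1
  rw [hu, coe_lorentzHom, exp_blockEmbedding, hinv, ← Matrix.exp_conjTranspose,
    Matrix.conjTranspose_neg]

/-- The traceless part of `(M + 1) / √(tr M + 2)`, the positive square root of a positive definite
Hermitian `2 × 2` matrix `M` of determinant one. -/
noncomputable def sqrtTracelessPart (M : Matrix (Fin 2) (Fin 2) ℂ) : ℝ × ℂ :=
  ((Real.sqrt (M.trace.re + 2))⁻¹ : ℝ) • ((M 0 0 - M 1 1).re / 2, M 0 1)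

theorem trace_mul_conjTranspose_nonneg (P : Matrix (Fin 2) (Fin 2) ℂ) :
    0 ≤ (P * P.conjTranspose).trace.re := by
  simp [Matrix.trace_fin_two, Matrix.mul_apply]
  nlinarith [sq_nonneg (P 0 0).re]

theorem continuous_sqrtTracelessPart : Continuous fun P : Matrix (Fin 2) (Fin 2) ℂ =>
    sqrtTracelessPart (P * P.conjTranspose) := by
  have hM : Continuous fun P : Matrix (Fin 2) (Fin 2) ℂ => P * P.conjTranspose := by fun_prop
  have h00 := hM.matrix_elem 0 0
  have h11 := hM.matrix_elem 1 1
  have h01 := hM.matrix_elem 0 1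
  have htr := hM.matrix_trace
  have hk : Continuous fun P : Matrix (Fin 2) (Fin 2) ℂ =>
      Real.sqrt ((P * P.conjTranspose).trace.re + 2) := by fun_prop
  refine Continuous.smul (hk.inv₀ fun P => ?_)
    (((Complex.continuous_re.comp (h00.sub h11)).div_const 2).prodMk h01)
  have := trace_mul_conjTranspose_nonneg P
  exact (Real.sqrt_pos.2 (by linarith)).ne'

/-- `posHermitian (sqrtTracelessPart (P Pᴴ))` is the positive factor in the polar decomposition of
`P`. -/
theorem posHermitian_sqrtTracelessPart_mul_self {P : Matrix (Fin 2) (Fin 2) ℂ} (hP : P.det = 1) :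
    posHermitian (sqrtTracelessPart (P * P.conjTranspose)) *
      posHermitian (sqrtTracelessPart (P * P.conjTranspose)) = P * P.conjTranspose := by
  have htr := trace_mul_conjTranspose_nonneg P
  have hdet : (P * P.conjTranspose).det = 1 := by
    rw [Matrix.det_mul, Matrix.det_conjTranspose, hP]
    simp
  have hherm : (P * P.conjTranspose).IsHermitian := Matrix.isHermitian_mul_conjTranspose_self P
  generalize P * P.conjTranspose = M at *
  obtain ⟨p, hp⟩ : ∃ p : ℝ, M 0 0 = p := ⟨_, (hherm.coe_re_apply_self 0).symm⟩
  obtain ⟨q, hq⟩ : ∃ q : ℝ, M 1 1 = q := ⟨_, (hherm.coe_re_apply_self 1).symm⟩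
  obtain ⟨z, hz⟩ : ∃ z, M 0 1 = z := ⟨_, rfl⟩
  have h10 : M 1 0 = conj z := by rw [← hz]; exact (hherm.apply 1 0).symm
  have hM : M = !![(p : ℂ), z; conj z, (q : ℂ)] := by
    rw [Matrix.eta_fin_two M, hp, hq, hz, h10]
  have htr' : M.trace.re = p + q := by simp [Matrix.trace_fin_two, hp, hq]
  have hdet' : (p : ℂ) * q - z * conj z = 1 := by
    rw [← hdet, hM, Matrix.det_fin_two_of]
  have hdet'' : p * q - Complex.normSq z = 1 := by
    rw [Complex.mul_conj] at hdet'
    exact_mod_cast hdet'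
  obtain ⟨k, hk⟩ : ∃ k, Real.sqrt (M.trace.re + 2) = k := ⟨_, rfl⟩
  have hk0 : 0 < k := hk ▸ Real.sqrt_pos.2 (by linarith)
  have hk2 : k ^ 2 = p + q + 2 := by rw [← hk, Real.sq_sqrt (by linarith), htr']
  have hv : sqrtTracelessPart M = ((p - q) / (2 * k), (k : ℂ)⁻¹ * z) := by
    rw [sqrtTracelessPart, hk, hp, hq, hz]
    ext1
    · simp
      field_simp
    · simp
  have hroot : Real.sqrt (1 + (((p - q) / (2 * k)) ^ 2 + Complex.normSq ((k : ℂ)⁻¹ * z))) =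
      k / 2 := by
    rw [Real.sqrt_eq_iff_mul_self_eq_of_pos (by positivity), Complex.normSq_mul,
      ← Complex.ofReal_inv, Complex.normSq_ofReal]
    field_simp
    linear_combination (k ^ 2 + p + q - 2) * hk2 + 4 * hdet''
  have hk0' : (k : ℂ) ≠ 0 := by exact_mod_cast hk0.ne'
  have hk2' : (k : ℂ) ^ 2 = p + q + 2 := by exact_mod_cast hk2
  rw [hv, posHermitian, hroot, hM]
  -- The root is `(M + 1) / k`, and `(M + 1) ^ 2 = (tr M + 2) • M` by Cayley-Hamilton.
  have hS : ((k / 2 : ℝ) : ℂ) • (1 : Matrix (Fin 2) (Fin 2) ℂ) +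
      tracelessHermitian ((p - q) / (2 * k), (k : ℂ)⁻¹ * z) =
        (k : ℂ)⁻¹ • !![(p : ℂ) + 1, z; conj z, (q : ℂ) + 1] := by
    ext i j
    fin_cases i <;> fin_cases j <;> simp [tracelessHermitian] <;> field_simp
    · linear_combination hk2'
    · linear_combination hk2'
  rw [hS]
  ext i j
  fin_cases i <;> fin_cases j <;> simp [Matrix.mul_apply] <;> field_simp
  · linear_combination -(p : ℂ) * hk2' - hdet'
  · linear_combination -z * hk2'
  · linear_combination -conj z * hk2'
  · linear_combination -(q : ℂ) * hk2' - hdet'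

/-- By the polar decomposition, `P ↦ P Pᴴ` identifies the quotient of `SL(2, ℂ)` by `SU(2)` with
the positive definite Hermitian matrices of determinant one, which are parametrised by their
traceless parts. -/
theorem simplyConnectedSpace_lorentz : SimplyConnectedSpace (homogeneousSpace lorentzG) := by
  let φ : Matrix (Fin 2 ⊕ Fin 2) (Fin 2 ⊕ Fin 2) ℂ → ℝ × ℂ := fun M =>
    sqrtTracelessPart (blockFst M * (blockFst M).conjTranspose)
  have hφ : Continuous φ := continuous_sqrtTracelessPart.comp continuous_blockFst
  have hφP : ∀ P, φ (lorentzHom P) = sqrtTracelessPart (P.1 * P.1.conjTranspose) := fun P => by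
    simp only [φ, coe_lorentzHom, blockFst_blockEmbedding]
  refine simplyConnectedSpace_quotient (diracSU2.subgroupOf lorentzG)
    (φ := fun a => φ a.1) (s := fun v => ⟨_, lorentzHom_slPosHermitian_mem v⟩)
    (hφ.comp (Units.continuous_val.comp continuous_subtype_val)) ?_
    (Continuous.subtype_mk continuous_lorentzHom_slPosHermitian _) ?_
  · rintro a h hh
    obtain ⟨P, hP⟩ := lorentzG_le_range a.2
    obtain ⟨U, hU⟩ := Subgroup.mem_subgroupOf.1 hh
    have hUV : U.1 * U.1.conjTranspose = 1 :=
      Matrix.mem_unitaryGroup_iff.1 (Matrix.mem_specialUnitaryGroup_iff.1 U.2).1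
    let V : SL(2, ℂ) := ⟨U.1, (Matrix.mem_specialUnitaryGroup_iff.1 U.2).2⟩
    have hPV : (P * V).1 = P.1 * U.1 := rfl
    rw [Subgroup.coe_mul, ← hU, ← hP, ← lorentzHom_eq_diracRep (P := V) U rfl, ← map_mul, hφP, hφP,
      hPV, Matrix.conjTranspose_mul, Matrix.mul_assoc, ← Matrix.mul_assoc U.1, hUV, Matrix.one_mul]
  · intro a
    obtain ⟨P, hP⟩ := lorentzG_le_range a.2
    let S : SL(2, ℂ) := slPosHermitian (φ a.1)
    have hS : S.1 = posHermitian (sqrtTracelessPart (P.1 * P.1.conjTranspose)) := by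
      rw [← hφP, hP]
      rfl
    have hSS : S.1 * S.1.conjTranspose = P.1 * P.1.conjTranspose := by
      rw [hS, conjTranspose_posHermitian, posHermitian_sqrtTracelessPart_mul_self P.2]
    have hinv : (P⁻¹ : SL(2, ℂ)).1 * P.1 = 1 := congrArg Subtype.val (inv_mul_cancel P)
    have hU : (P⁻¹ * S).1 ∈ Matrix.specialUnitaryGroup (Fin 2) ℂ := by
      refine Matrix.mem_specialUnitaryGroup_iff.2 ⟨Matrix.mem_unitaryGroup_iff.2 ?_, (P⁻¹ * S).2⟩
      change (P⁻¹ : SL(2, ℂ)).1 * S.1 * ((P⁻¹ : SL(2, ℂ)).1 * S.1).conjTranspose = 1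
      rw [Matrix.conjTranspose_mul, Matrix.mul_assoc, ← Matrix.mul_assoc S.1, hSS,
        Matrix.mul_assoc, ← Matrix.mul_assoc, hinv, Matrix.one_mul, ← Matrix.conjTranspose_mul,
        hinv, Matrix.conjTranspose_one]
    refine Subgroup.mem_subgroupOf.2 ⟨⟨_, hU⟩, ?_⟩
    change diracRep _ = (a : Matrix.GeneralLinearGroup (Fin 2 ⊕ Fin 2) ℂ)⁻¹ * lorentzHom S
    rw [← hP, ← map_inv, ← map_mul]
    exact (lorentzHom_eq_diracRep _ rfl).symm

theorem mainTheorem3 :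
    ((∀ u ∈ compactG, (u : Matrix (Fin 2 ⊕ Fin 2) (Fin 2 ⊕ Fin 2) ℂ) ∈
          Matrix.specialUnitaryGroup (Fin 2 ⊕ Fin 2) ℂ) ∧
      IsCompact (compactG : Set (Matrix.GeneralLinearGroup (Fin 2 ⊕ Fin 2) ℂ)) ∧
      diracSU2 ≤ compactG ∧
      PathConnectedSpace (homogeneousSpace compactG) ∧
      ∀ x : homogeneousSpace compactG,
        Subsingleton (FundamentalGroup (homogeneousSpace compactG) x)) ∧
    (diracSU2 ≤ lorentzG ∧
      PathConnectedSpace (homogeneousSpace lorentzG) ∧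
      ∀ x : homogeneousSpace lorentzG,
        Subsingleton (FundamentalGroup (homogeneousSpace lorentzG) x)) := by
  have h1 := simplyConnectedSpace_compact
  have h2 := simplyConnectedSpace_lorentz
  exact ⟨⟨fun u hu => compactG_le_specialUnitaryGroup hu, isCompact_compactG, diracSU2_le_compactG,
    inferInstance, fun x => inferInstance⟩, diracSU2_le_lorentzG, inferInstance,
    fun x => inferInstance⟩
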